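/- Let $G$ be a finite group. For $a,b\in G$ write ${}^{a}b=aba^{-1}$ and $[a,b]=aba^{-1}b^{-1}$. The nonabelian tensor square $G\otimes G$ is the group generated by the symbols $x\otimes y$ ($x,y\in G$) subject to the relations $$xy\otimes h=({}^{x}y\otimes {}^{x}h)(x\otimes h),\qquad x\otimes hk=(x\otimes h)({}^{h}x\otimes {}^{h}k)\qquad (x,y,h,k\in G).$$ Let $\kappa\colon G\otimes G\to G'$ be the homomorphism with $\kappa(x\otimes y)=[x,y]$, and put $$J_2(G)=\ker\kappa,\qquad Z^{\otimes}(G)=\{g\in G : g\otimes y=1 \text{ for all } y\in G\},$$ $$d^{\otimes}(G)=\frac{|\{(x,y)\in G\times G : x\otimes y=1\}|}{|G|^2},\qquad d(G)=\frac{|\{(x,y)\in G\times G : [x,y]=1\}|}{|G|^2}.$$ Suppose that $G$ is nontrivial and let $p$ be the smallest prime divisor of $|G|$. Then $J_2(G)$ is finite and $$\frac{d(G)}{|J_2(G)|}+\frac{|Z^{\otimes}(G)|}{|G|}\left(1-\frac{1}{|J_2(G)|}\right)\ \le\ d^{\otimes}(G)\ \le\ d(G)-\left(1-\frac1p\right)\frac{|Z(G)|-|Z^{\otimes}(G)|}{|G|},$$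 where $Z(G)$ is the center of $G$. -/

import Mathlib

namespace TensorDegree

open scoped commutatorElement

/-- The defining relations of the nonabelian tensor square, as words in the free group on the
symbols `(x, y)` (standing for `x ⊗ y`), where `ᵃb = a * b * a⁻¹`:
`xy ⊗ h = (ˣy ⊗ ˣh) (x ⊗ h)` and `x ⊗ hk = (x ⊗ h) (ʰx ⊗ ʰk)`. -/
def tensorRels (G : Type*) [Group G] : Set (FreeGroup (G × G)) :=
  {r | ∃ x y h : G, r = FreeGroup.of (x * y, h) *
      (FreeGroup.of (x * y * x⁻¹, x * h * x⁻¹) * FreeGroup.of (x, h))⁻¹} ∪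
  {r | ∃ x h k : G, r = FreeGroup.of (x, h * k) *
      (FreeGroup.of (x, h) * FreeGroup.of (h * x * h⁻¹, h * k * h⁻¹))⁻¹}

/-- The nonabelian tensor square `G ⊗ G` (with the conjugation action). -/
abbrev TensorSquare (G : Type*) [Group G] : Type _ :=
  PresentedGroup (tensorRels G)

/-- The generator `x ⊗ y` of the nonabelian tensor square. -/
def tmul {G : Type*} [Group G] (x y : G) : TensorSquare G :=
  PresentedGroup.of (x, y)

/-- The commutator `[x, y] = x y x⁻¹ y⁻¹`, as an element of the derived subgroup. -/
def commElt {G : Type*} [Group G] (z : G × G) : commutator G :=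
  ⟨⁅z.1, z.2⁆, Subgroup.commutator_mem_commutator (Subgroup.mem_top _) (Subgroup.mem_top _)⟩

theorem commElt_rels (G : Type*) [Group G] :
    ∀ r ∈ tensorRels G, FreeGroup.lift (commElt (G := G)) r = 1 := by
  rintro r (⟨x, y, h, rfl⟩ | ⟨x, h, k, rfl⟩)
  · apply Subtype.ext
    simp only [map_mul, map_inv, FreeGroup.lift_apply_of, commElt, Subgroup.coe_mul,
      Subgroup.coe_inv, Subgroup.coe_one, commutatorElement_def]
    group
  · apply Subtype.ext
    simp only [map_mul, map_inv, FreeGroup.lift_apply_of, commElt, Subgroup.coe_mul,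
      Subgroup.coe_inv, Subgroup.coe_one, commutatorElement_def]
    group

/-- The commutator map `κ : G ⊗ G → G'`, the homomorphism with `κ (x ⊗ y) = [x, y]`. -/
def kappa (G : Type*) [Group G] : TensorSquare G →* commutator G :=
  PresentedGroup.toGroup (commElt_rels G)

/-- `J₂(G)`, the kernel of the commutator map. -/
def J2 (G : Type*) [Group G] : Subgroup (TensorSquare G) :=
  (kappa G).ker

/-- The tensor center `Z^⊗(G)`, the set of all `g` with `g ⊗ y = 1` for all `y`. -/
def tensorCenter (G : Type*) [Group G] : Set G :=
  {g | ∀ y : G, tmul g y = 1}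

/-- The tensor degree `d^⊗(G)`, the proportion of pairs `(x, y)` with `x ⊗ y = 1`. -/
noncomputable def tensorDegree (G : Type*) [Group G] : ℚ :=
  Nat.card {z : G × G // tmul z.1 z.2 = 1} / (Nat.card G : ℚ) ^ 2

end TensorDegree

namespace TensorDegree

open scoped commutatorElement

section Tensor

variable {G : Type*} [Group G]

/-! `G` acts on the tensor square by diagonal conjugation, and `κ(t)` acts as conjugation by `t`
(`act_kappa`). Together with `κ(t) ⊗ h = t (ʰt)⁻¹` (`kappa_tmul_eq`) this makes `J₂(G)` central and
fixed by `G`.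

Hence `y ↦ x ⊗ y` is a homomorphism from the centralizer `C(x)` to `J₂(G)` whose kernel is the
tensor centralizer of `x`, so the latter has index at most `|J₂(G)|` in `C(x)`. Summing over `x`
gives the lower bound, improved at `x` in `Z^⊗(G)`, where both centralizers are `G`. The upper bound
holds because for `x` in `Z(G)` outside `Z^⊗(G)` the tensor centralizer is proper, so of index at
least `p`.

Finiteness: `J₂(G)` is abelian and finitely generated, having finite index in a finitely generated
group; a transfer argument shows that it is torsion. -/

theorem tmul_mul_left' (x y h : G) :
    tmul (x * y) h = tmul (x * y * x⁻¹) (x * h * x⁻¹) * tmul x h := by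
  have := PresentedGroup.one_of_mem (rels := tensorRels G) (Or.inl ⟨x, y, h, rfl⟩)
  rw [map_mul, map_inv, map_mul, mul_inv_eq_one] at this
  exact this

theorem tmul_mul_right' (x h k : G) :
    tmul x (h * k) = tmul x h * tmul (h * x * h⁻¹) (h * k * h⁻¹) := by
  have := PresentedGroup.one_of_mem (rels := tensorRels G) (Or.inr ⟨x, h, k, rfl⟩)
  rw [map_mul, map_inv, map_mul, mul_inv_eq_one] at this
  exact this

theorem conj_rels (g : G) : ∀ r ∈ tensorRels G,
    FreeGroup.lift (fun z : G × G => tmul (g * z.1 * g⁻¹) (g * z.2 * g⁻¹)) r = 1 := by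
  rintro r (⟨x, y, h, rfl⟩ | ⟨x, h, k, rfl⟩)
  · simp only [map_mul, map_inv, FreeGroup.lift_apply_of, mul_inv_eq_one]
    rw [show g * (x * y) * g⁻¹ = (g * x * g⁻¹) * (g * y * g⁻¹) by group, tmul_mul_left']
    congr 2 <;> group
  · simp only [map_mul, map_inv, FreeGroup.lift_apply_of, mul_inv_eq_one]
    rw [show g * (h * k) * g⁻¹ = (g * h * g⁻¹) * (g * k * g⁻¹) by group, tmul_mul_right']
    congr 2 <;> group

/-- The diagonal conjugation action of `g` on the tensor square. -/
def act (g : G) : TensorSquare G →* TensorSquare G :=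
  PresentedGroup.toGroup (conj_rels g)

@[simp]
theorem act_tmul (g x y : G) :
    act g (tmul x y) = tmul (g * x * g⁻¹) (g * y * g⁻¹) :=
  PresentedGroup.toGroup.of (conj_rels g)

theorem hom_ext {M : Type*} [Group M] {φ ψ : TensorSquare G →* M}
    (h : ∀ x y, φ (tmul x y) = ψ (tmul x y)) : φ = ψ :=
  PresentedGroup.ext fun z : G × G => h z.1 z.2

theorem tensor_induction {P : TensorSquare G → Prop} (tmul : ∀ x y, P (tmul x y))
    (one : P 1) (mul : ∀ s t, P s → P t → P (s * t)) (inv : ∀ t, P t → P t⁻¹)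
    (t : TensorSquare G) : P t := by
  have ht : t ∈ Subgroup.closure
      (Set.range (PresentedGroup.of : G × G → PresentedGroup (tensorRels G))) := by
    rw [PresentedGroup.closure_range_of]; trivial
  induction ht using Subgroup.closure_induction with
  | mem _ h => obtain ⟨z, rfl⟩ := h; exact tmul z.1 z.2
  | one => exact one
  | mul _ _ _ _ h₁ h₂ => exact mul _ _ h₁ h₂
  | inv _ _ h => exact inv _ h

theorem act_act (g h : G) (t : TensorSquare G) : act g (act h t) = act (g * h) t := by
  have : (act g).comp (act h) = act (g * h) := hom_ext fun x y => by
    simp only [MonoidHom.comp_apply, act_tmul]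
    congr 1 <;> group
  exact DFunLike.congr_fun this t

@[simp]
theorem act_one (t : TensorSquare G) : act 1 t = t := by
  have : act (1 : G) = MonoidHom.id _ := hom_ext fun x y => by simp
  exact DFunLike.congr_fun this t

theorem tmul_mul_left (x y h : G) : tmul (x * y) h = act x (tmul y h) * tmul x h := by
  rw [act_tmul, tmul_mul_left']

theorem tmul_mul_right (x h k : G) : tmul x (h * k) = tmul x h * act h (tmul x k) := by
  rw [act_tmul, tmul_mul_right']

@[simp]
theorem one_tmul (y : G) : tmul 1 y = 1 := by
  have := tmul_mul_left 1 1 y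
  rw [act_one, one_mul] at this
  exact left_eq_mul.mp this

@[simp]
theorem tmul_one (x : G) : tmul x 1 = 1 := by
  have := tmul_mul_right x 1 1
  rw [act_one, one_mul] at this
  exact left_eq_mul.mp this

theorem act_tmul_inv_left (x y : G) : act x (tmul x⁻¹ y) = (tmul x y)⁻¹ := by
  rw [eq_inv_iff_mul_eq_one, ← tmul_mul_left, mul_inv_cancel, one_tmul]

theorem inv_tmul (x y : G) : tmul x⁻¹ y = act x⁻¹ (tmul x y)⁻¹ := by
  rw [← act_tmul_inv_left, act_act, inv_mul_cancel, act_one]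

theorem tmul_inv (x y : G) : tmul x y⁻¹ = act y⁻¹ (tmul x y)⁻¹ := by
  have : act y (tmul x y⁻¹) = (tmul x y)⁻¹ := by
    rw [eq_inv_iff_mul_eq_one, mul_eq_one_comm, ← tmul_mul_right, mul_inv_cancel, tmul_one]
  rw [← this, act_act, inv_mul_cancel, act_one]

@[simp]
theorem kappa_tmul (x y : G) : (kappa G (tmul x y) : G) = ⁅x, y⁆ := by
  have : kappa G (tmul x y) = commElt (x, y) := PresentedGroup.toGroup.of (commElt_rels G)
  rw [this]; rfl

/-- Expanding `xy ⊗ hk` in the two possible orders and cancelling the common outer factors gives the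
case `s = y ⊗ k`. -/
theorem tmul_mul_act_eq (x h : G) (s : TensorSquare G) :
    tmul x h * act (h * x) s * (tmul x h)⁻¹ = act (x * h) s := by
  have : ((MulAut.conj (tmul x h)).toMonoidHom).comp (act (h * x)) = act (x * h) :=
    hom_ext fun y k => by
      have e₁ := tmul_mul_right (x * y) h k
      have e₂ := tmul_mul_left x y (h * k)
      rw [tmul_mul_left x y h, tmul_mul_left x y k, map_mul, act_act] at e₁
      rw [tmul_mul_right y h k, tmul_mul_right x h k, map_mul, act_act] at e₂
      have e := e₁.symm.trans e₂
      simp only [mul_assoc, mul_right_inj] at e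
      simp only [← mul_assoc, mul_left_inj] at e
      simp only [MonoidHom.comp_apply, MulEquiv.coe_toMonoidHom, MulAut.conj_apply]
      rw [e, mul_inv_cancel_right]
  exact DFunLike.congr_fun this s

theorem act_commutator (x h : G) (s : TensorSquare G) :
    act ⁅x, h⁆ s = tmul x h * s * (tmul x h)⁻¹ := by
  have := tmul_mul_act_eq x h (act (h * x)⁻¹ s)
  rw [act_act, act_act, mul_inv_cancel, act_one] at this
  rw [this, commutatorElement_def]
  congr 2
  group

/-- The tensor square acts on itself by conjugation through `κ`. -/
theorem act_kappa (t s : TensorSquare G) : act (kappa G t : G) s = t * s * t⁻¹ := by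
  induction t using tensor_induction generalizing s with
  | tmul x y => rw [kappa_tmul, act_commutator]
  | one => simp
  | mul t u ht hu =>
    rw [map_mul, Subgroup.coe_mul, ← act_act, hu, ht]
    group
  | inv t ht =>
    have h := ht (act (kappa G t : G)⁻¹ s)
    rw [act_act, mul_inv_cancel, act_one] at h
    rw [map_inv, Subgroup.coe_inv]
    conv_rhs => rw [h]
    group

theorem commutator_tmul (x y h : G) :
    tmul ⁅x, y⁆ h = tmul x y * (act h (tmul x y))⁻¹ := by
  have e₁ : tmul x (y⁻¹ * (h * y)) =
      act y⁻¹ ((tmul x y)⁻¹ * tmul x h * act h (tmul x y)) := by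
    rw [tmul_mul_right, tmul_mul_right, tmul_inv, ← map_mul, mul_assoc]
  -- `yx⁻¹y⁻¹ ⊗ h` is the `y`-translate of `x⁻¹ ⊗ y⁻¹hy`, which `e₁` evaluates.
  have e₂ : act x (tmul (y * x⁻¹ * y⁻¹) h) =
      act ⁅x, y⁆ ((tmul x y)⁻¹ * tmul x h * act h (tmul x y))⁻¹ := by
    have : tmul (y * x⁻¹ * y⁻¹) h = act y (tmul x⁻¹ (y⁻¹ * (h * y))) := by
      rw [act_tmul]; congr 1; group
    rw [this, inv_tmul, e₁, ← map_inv, act_act, act_act, act_act, commutatorElement_def]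
  rw [show ⁅x, y⁆ = x * (y * x⁻¹ * y⁻¹) by rw [commutatorElement_def]; group,
    tmul_mul_left, e₂, act_commutator]
  group

theorem kappa_tmul_eq (t : TensorSquare G) (h : G) :
    tmul (kappa G t : G) h = t * (act h t)⁻¹ := by
  induction t using tensor_induction with
  | tmul x y => rw [kappa_tmul, commutator_tmul]
  | one => simp
  | mul t u ht hu =>
    rw [map_mul, Subgroup.coe_mul, tmul_mul_left, ht, hu, act_kappa, map_mul]
    group
  | inv t ht =>
    rw [map_inv, Subgroup.coe_inv, inv_tmul, ht, ← Subgroup.coe_inv, ← map_inv, act_kappa, map_inv]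
    group

theorem act_eq_self_of_mem_J2 {t : TensorSquare G} (ht : t ∈ J2 G) (g : G) : act g t = t := by
  have h := kappa_tmul_eq t g
  rw [(MonoidHom.mem_ker.mp ht : kappa G t = 1), Subgroup.coe_one, one_tmul] at h
  exact (mul_inv_eq_one.mp h.symm).symm

theorem J2_le_center : J2 G ≤ Subgroup.center (TensorSquare G) := by
  intro t ht
  rw [Subgroup.mem_center_iff]
  intro s
  have h := act_kappa t s
  rw [(MonoidHom.mem_ker.mp ht : kappa G t = 1), Subgroup.coe_one, act_one] at h
  rw [eq_mul_inv_iff_mul_eq] at h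
  exact h

/-! ### Finiteness -/

theorem J2_index_ne_zero [Finite G] : (J2 G).index ≠ 0 := by
  rw [J2, Subgroup.index_ker]
  exact Nat.card_pos.ne'

theorem center_index_ne_zero [Finite G] : (Subgroup.center (TensorSquare G)).index ≠ 0 :=
  ne_zero_of_dvd_ne_zero J2_index_ne_zero (Subgroup.index_dvd_of_le J2_le_center)

/-- Once the action of `G` is killed, the second defining relation is multiplicativity in `y`, so
Lagrange's theorem in `G` applies. -/
theorem tmul_pow_eq_one_of_hom [Finite G] {A : Type*} [Group A] (ψ : TensorSquare G →* A)
    (hψ : ∀ g t, ψ (act g t) = ψ t) (x y : G) : ψ (tmul x y) ^ Nat.card G = 1 := by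
  let f : G →* A :=
    { toFun := fun y => ψ (tmul x y)
      map_one' := by simp
      map_mul' := fun h k => by rw [tmul_mul_right, map_mul, hψ] }
  change f y ^ _ = 1
  rw [← map_pow, pow_card_eq_one', map_one]

/-- A power of the transfer to the center is invariant under `G`, hence torsion. -/
theorem exists_pow_eq_one [Finite G] : ∃ n ≠ 0, ∀ t : TensorSquare G, t ^ n = 1 := by
  have : (Subgroup.center (TensorSquare G)).FiniteIndex := ⟨center_index_ne_zero⟩
  set n := (Subgroup.center (TensorSquare G)).index
  set m := (J2 G).index
  have hJ : ∀ t : TensorSquare G, t ^ m ∈ J2 G := fun t => by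
    have : (J2 G).Normal := by unfold J2; infer_instance
    exact Subgroup.pow_index_mem _ t
  have hcomm : ∀ a b : Subgroup.center (TensorSquare G), Commute a b := fun a b =>
    Subtype.ext (Subgroup.mem_center_iff.mp b.2 a)
  -- The transfer to the center is `t ↦ t ^ n`. The extra power `m` moves `t` into `J2 G`, where `G`
  -- acts trivially, which makes `ψ` invariant.
  let ψ : TensorSquare G →* Subgroup.center (TensorSquare G) :=
    { toFun := fun t => MonoidHom.transferCenterPow (TensorSquare G) t ^ m
      map_one' := by simp
      map_mul' := fun s t => by rw [map_mul, (hcomm _ _).mul_pow] }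
  have hψ : ∀ t, (ψ t : TensorSquare G) = (t ^ m) ^ n := fun t => by
    change ((MonoidHom.transferCenterPow (TensorSquare G) t ^ m :
      Subgroup.center (TensorSquare G)) : TensorSquare G) = _
    rw [Subgroup.coe_pow, MonoidHom.transferCenterPow_apply, ← pow_mul, ← pow_mul, mul_comm]
  have hinv : ∀ g t, ψ (act g t) = ψ t := fun g t => by
    apply Subtype.ext
    rw [hψ, hψ, ← map_pow, act_eq_self_of_mem_J2 (hJ t)]
  have hker : ∀ t, ψ t ^ Nat.card G = 1 := fun t => by
    induction t using tensor_induction with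
    | tmul x y => exact tmul_pow_eq_one_of_hom ψ hinv x y
    | one => rw [map_one, one_pow]
    | mul s t hs ht => rw [map_mul, (hcomm _ _).mul_pow, hs, ht, mul_one]
    | inv t ht => rw [map_inv, inv_pow, ht, inv_one]
  refine ⟨m * n * Nat.card G, mul_ne_zero
    (mul_ne_zero J2_index_ne_zero center_index_ne_zero) Nat.card_pos.ne', fun t => ?_⟩
  rw [pow_mul, pow_mul, ← hψ, ← Subgroup.coe_pow]
  exact congrArg Subtype.val (hker t)

theorem finite_J2 [Finite G] : Finite (J2 G) := by
  have : (J2 G).FiniteIndex := ⟨J2_index_ne_zero⟩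
  have : Group.FG (TensorSquare G) := Group.fg_iff.mpr
    ⟨_, PresentedGroup.closure_range_of (tensorRels G), Set.finite_range _⟩
  have : Group.FG (J2 G) := Subgroup.fg_of_index_ne_zero _
  let _ : CommGroup (J2 G) :=
    { mul_comm := fun a b => Subtype.ext ((Subgroup.mem_center_iff.mp (J2_le_center b.2)) a) }
  apply CommGroup.finite_of_fg_isMulTorsion
  obtain ⟨n, hn, h⟩ := exists_pow_eq_one (G := G)
  intro t
  rw [isOfFinOrder_iff_pow_eq_one]
  exact ⟨n, Nat.pos_of_ne_zero hn, Subtype.ext (h t)⟩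

/-! ### Tensor centralizers -/

/-- The tensor centralizer of `x`, consisting of all `y` with `x ⊗ y = 1`. -/
def tensorCentralizer (x : G) : Subgroup G where
  carrier := {y | tmul x y = 1}
  one_mem' := tmul_one x
  mul_mem' {a b} ha hb := by
    simp only [Set.mem_ofPred_eq] at *
    rw [tmul_mul_right, ha, hb, map_one, mul_one]
  inv_mem' {a} ha := by
    simp only [Set.mem_ofPred_eq] at *
    rw [tmul_inv, ha, inv_one, map_one]

theorem mem_tensorCentralizer {x y : G} : y ∈ tensorCentralizer x ↔ tmul x y = 1 := Iff.rfl

theorem commutator_eq_one_of_tmul_eq_one {x y : G} (h : tmul x y = 1) : ⁅x, y⁆ = 1 := by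
  rw [← kappa_tmul, h, map_one, Subgroup.coe_one]

theorem tensorCentralizer_le (x : G) : tensorCentralizer x ≤ Subgroup.centralizer {x} := by
  intro y hy
  rw [Subgroup.mem_centralizer_singleton_iff]
  exact (commutatorElement_eq_one_iff_mul_comm.mp (commutator_eq_one_of_tmul_eq_one hy)).symm

theorem tmul_mem_J2 {x y : G} (h : y ∈ Subgroup.centralizer {x}) : tmul x y ∈ J2 G := by
  rw [Subgroup.mem_centralizer_singleton_iff] at h
  refine MonoidHom.mem_ker.mpr (Subtype.ext ?_)
  rw [kappa_tmul, Subgroup.coe_one, commutatorElement_eq_one_iff_mul_comm, h]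

/-- The homomorphism `y ↦ x ⊗ y` on the centralizer of `x`. -/
def centralizerHom (x : G) : Subgroup.centralizer {x} →* J2 G where
  toFun y := ⟨tmul x y, tmul_mem_J2 y.2⟩
  map_one' := Subtype.ext (tmul_one x)
  map_mul' a b := Subtype.ext <| by
    simp only [Subgroup.coe_mul]
    rw [tmul_mul_right, act_eq_self_of_mem_J2 (tmul_mem_J2 b.2)]

theorem card_centralizer_le [Finite G] (x : G) :
    Nat.card (Subgroup.centralizer {x}) ≤ Nat.card (J2 G) * Nat.card (tensorCentralizer x) := by
  have := finite_J2 (G := G)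
  have h := (centralizerHom x).ker.card_mul_index
  rw [Subgroup.index_ker] at h
  rw [← h, mul_comm]
  refine Nat.mul_le_mul (Subgroup.card_le_card_group _) ?_
  refine Nat.card_le_card_of_injective
    (fun y => (⟨y.1.1, congrArg Subtype.val (MonoidHom.mem_ker.mp y.2)⟩ :
      tensorCentralizer x)) ?_
  intro a b hab
  exact Subtype.ext (Subtype.ext (congrArg (fun y : tensorCentralizer x => (y : G)) hab))

theorem tensorCentralizer_eq_top_iff {x : G} : tensorCentralizer x = ⊤ ↔ x ∈ tensorCenter G := by
  rw [Subgroup.eq_top_iff']; rfl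

theorem tensorCenter_subset_center : tensorCenter G ⊆ Subgroup.center G := by
  intro x hx
  rw [SetLike.mem_coe, Subgroup.mem_center_iff]
  intro y
  exact (commutatorElement_eq_one_iff_mul_comm.mp (commutator_eq_one_of_tmul_eq_one (hx y))).symm

/-- The least prime factor of the index of `H` divides `|G|`, so it is at least `p`. -/
theorem mul_card_le_card_of_ne_top [Finite G] {p : ℕ}
    (hp : IsLeast {q : ℕ | q.Prime ∧ q ∣ Nat.card G} p) {H : Subgroup G} (hH : H ≠ ⊤) :
    p * Nat.card H ≤ Nat.card G := by
  rw [← H.card_mul_index, mul_comm]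
  have h1 : H.index ≠ 1 := fun h => hH (Subgroup.index_eq_one.mp h)
  exact Nat.mul_le_mul_left _ ((hp.2 ⟨Nat.minFac_prime h1,
    (Nat.minFac_dvd _).trans H.index_dvd_card⟩).trans
      (Nat.minFac_le (Nat.pos_of_ne_zero H.index_ne_zero_of_finite)))

end Tensor

/-! ### Counting -/

theorem card_subtype_prod {α : Type*} [Fintype α] (P : α → α → Prop) :
    Nat.card {z : α × α // P z.1 z.2} = ∑ x, Nat.card {y // P x y} := by
  rw [Nat.card_congr (Equiv.subtypeProdEquivSigmaSubtype P), Nat.card_sigma]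

theorem tensorDegree_eq_sum {G : Type*} [Group G] [Fintype G] :
    tensorDegree G = (∑ x : G, (Nat.card (tensorCentralizer x) : ℚ)) / (Nat.card G : ℚ) ^ 2 := by
  rw [tensorDegree, card_subtype_prod (fun x y : G => tmul x y = 1), Nat.cast_sum]
  rfl

theorem commProb_eq_sum {G : Type*} [Group G] [Fintype G] :
    commProb G =
      (∑ x : G, (Nat.card (Subgroup.centralizer {x}) : ℚ)) / (Nat.card G : ℚ) ^ 2 := by
  rw [commProb, card_subtype_prod (fun x y : G => Commute x y), Nat.cast_sum]
  congr 1
  refine Finset.sum_congr rfl fun x _ => ?_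
  congr 1
  refine Nat.card_congr (Equiv.subtypeEquivRight fun y => ?_)
  rw [Subgroup.mem_centralizer_singleton_iff]
  exact eq_comm

open Classical in
theorem sum_ite_mem_eq {α : Type*} [Fintype α] (S : Set α) (a : ℚ) :
    ∑ x, (if x ∈ S then a else 0) = Nat.card S * a := by
  rw [← Finset.sum_filter, Finset.sum_const, nsmul_eq_mul, Nat.card_eq_fintype_card,
    Fintype.card_subtype]

end TensorDegree

open TensorDegree in
theorem theorem2p3 {G : Type*} [Group G] [Finite G] (p : ℕ)
    (hp : IsLeast {q : ℕ | q.Prime ∧ q ∣ Nat.card G} p) :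
    Finite (J2 G) ∧
    commProb G / (Nat.card (J2 G) : ℚ)
        + (Nat.card (tensorCenter G) : ℚ) / (Nat.card G : ℚ)
          * (1 - 1 / (Nat.card (J2 G) : ℚ))
      ≤ tensorDegree G ∧
    tensorDegree G ≤
      commProb G - (1 - 1 / (p : ℚ))
        * (((Nat.card (Subgroup.center G) : ℚ) - (Nat.card (tensorCenter G) : ℚ))
          / (Nat.card G : ℚ)) := by
  classical
  have hfin := finite_J2 (G := G)
  have := Fintype.ofFinite G
  have hG : (0 : ℚ) < Nat.card G := by exact_mod_cast Nat.card_pos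
  have hj : (0 : ℚ) < Nat.card (J2 G) := by exact_mod_cast Nat.card_pos
  have hp0 : (0 : ℚ) < p := by exact_mod_cast hp.1.1.pos
  have htop : ∀ x : G, x ∈ tensorCenter G → Nat.card (tensorCentralizer x) = Nat.card G :=
    fun x hx => by rw [tensorCentralizer_eq_top_iff.mpr hx, Subgroup.card_top]
  have hcent : ∀ x : G, x ∈ Subgroup.center G →
      Nat.card (Subgroup.centralizer {x}) = Nat.card G := fun x hx => by
    rw [Subgroup.centralizer_eq_top_iff_subset.mpr (Set.singleton_subset_iff.mpr hx),
      Subgroup.card_top]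
  refine ⟨hfin, ?_, ?_⟩
  · have key : ∀ x : G, (Nat.card (Subgroup.centralizer {x}) : ℚ) / Nat.card (J2 G)
        + (if x ∈ tensorCenter G then (Nat.card G : ℚ) * (1 - 1 / Nat.card (J2 G)) else 0)
        ≤ Nat.card (tensorCentralizer x) := by
      intro x
      split_ifs with hx
      · rw [htop x hx, hcent x (tensorCenter_subset_center hx)]
        apply le_of_eq; ring
      · rw [add_zero, div_le_iff₀' hj]
        exact_mod_cast card_centralizer_le x
    have hs := Finset.sum_le_sum fun x (_ : x ∈ Finset.univ) => key x
    rw [Finset.sum_add_distrib, ← Finset.sum_div, sum_ite_mem_eq] at hs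
    rw [tensorDegree_eq_sum, commProb_eq_sum, le_div_iff₀ (by positivity)]
    refine le_trans (le_of_eq ?_) hs
    field_simp
  -- The two indicator terms cancel on `Z^⊗(G)`; the gain `|G| (1 - 1/p)` survives exactly on `Z(G)`
  -- minus `Z^⊗(G)`.
  · have key : ∀ x : G, (Nat.card (tensorCentralizer x) : ℚ)
        + (if x ∈ (Subgroup.center G : Set G) then (Nat.card G : ℚ) * (1 - 1 / p) else 0)
        ≤ Nat.card (Subgroup.centralizer {x})
          + (if x ∈ tensorCenter G then (Nat.card G : ℚ) * (1 - 1 / p) else 0) := by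
      intro x
      by_cases hx : x ∈ tensorCenter G
      · rw [if_pos hx, if_pos (tensorCenter_subset_center hx), htop x hx,
          hcent x (tensorCenter_subset_center hx)]
      · rw [if_neg hx, add_zero]
        split_ifs with hz
        · have h := mul_card_le_card_of_ne_top hp (mt tensorCentralizer_eq_top_iff.mp hx)
          have h' : (Nat.card (tensorCentralizer x) : ℚ) ≤ Nat.card G / p := by
            rw [le_div_iff₀' hp0]
            exact_mod_cast h
          rw [hcent x hz]
          calc _ ≤ (Nat.card G : ℚ) / p + Nat.card G * (1 - 1 / p) := by gcongr
            _ = _ := by ring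
        · rw [add_zero]
          exact_mod_cast Nat.card_le_card_of_injective _
            (Subgroup.inclusion_injective (tensorCentralizer_le x))
    have hs := Finset.sum_le_sum fun x (_ : x ∈ Finset.univ) => key x
    rw [Finset.sum_add_distrib, Finset.sum_add_distrib, sum_ite_mem_eq, sum_ite_mem_eq] at hs
    rw [tensorDegree_eq_sum, commProb_eq_sum, div_le_iff₀ (by positivity)]
    refine (le_sub_iff_add_le.mpr hs).trans (le_of_eq ?_)
    simp only [SetLike.coe_sort_coe]
    field_simp
    ring
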